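/- Throughout, $k,p,m,n\ge 1$ are integers and $M_n$ denotes the complex $n\times n$ matrices. **Definitions.** Let $M_n(M_m)\cong M_n\otimes M_m$ carry its usual cone $M_n(M_m)^+$ of positive semidefinite $nm\times nm$ matrices, and let $I$ denote its identity. Set $$D_n^{k\text{-}\max}(M_m)=\{ADA^*: q\in\mathbb N,\ A\in M_{n,qk},\ D=\operatorname{diag}(D_1,\dots,D_q),\ D_l\in M_k(M_m)^+\},$$ where $ADA^*=(A\otimes I_m)D(A\otimes I_m)^*$. The operator system $\mathrm{OMAX}_k(M_m)$ is $M_m$ with the matrix cones $$C_n^{k\text{-}\max}(M_m)=\{X\in M_n(M_m): rI+X\in D_n^{k\text{-}\max}(M_m)\text{ for all } r>0\}.$$ For a linear map $\phi:M_p\to M_m$ let $\phi^{(n)}:M_n(M_p)\to M_n(M_m)$ apply $\phi$ to each entry. The map $\phi:M_p\to\mathrm{OMAX}_k(M_m)$ is *completely positive* if $\phi^{(n)}(M_n(M_p)^+)\subseteq C_n^{k\text{-}\max}(M_m)$ for all $n\ge 1$. The *Schmidt rank* of $U\in\mathbb C^n\otimes\mathbb C^p$ is the least number $r$ of terms in an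 expression $U=\sum_{e=1}^r\alpha_e\,u_e\otimes v_e$ with $\alpha_e\ge 0$ and orthonormal systems $(u_e)$ in $\mathbb C^n$, $(v_e)$ in $\mathbb C^p$. The *Schmidt number* of a positive semidefinite matrix $\rho$ on $\mathbb C^n\otimes\mathbb C^p$ is the least $j$ such that $\rho$ is a finite sum of matrices $UU^*$ with $U$ of Schmidt rank at most $j$. A state $s$ on $M_n\otimes M_p$ (a positive linear functional with $s(I)=1$) is *$k$-separable* if its density matrix $\rho_s=(s(E_{ij}\otimes E_{kl}))$, whose $(i,j)$ block has $(k,l)$ entry $s(E_{ij}\otimes E_{kl})$, has Schmidt number at most $k$. A positive linear functional $f$ on $M_n\otimes M_p$ is *$k$-separable* if $f=0$ or $f/f(I)$ is a $k$-separable state. A linear map $\phi:M_p\to M_m$ is *$k$-partially entanglement breaking* if, for every $n\ge1$ and every state $s$ on $M_n\otimes M_m$, the functional $s\circ\phi^{(n)}$ on $M_n\otimes M_p$ is positive and $k$-separable. **Corollary.** Let $\phi:M_p\to M_m$ be a linear map. If $\phi:M_p\to\mathrm{OMAX}_k(M_m)$ is completely positive, then $\phi$ is $k$-partially entanglement breaking.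 -/

import Mathlib

open scoped ComplexOrder

namespace OpSys

/-- `M_n`, the complex `n × n` matrices. -/
abbrev Mat (n : ℕ) : Type := Matrix (Fin n) (Fin n) ℂ

/-- A family of subsets `C_n ⊆ M_n(V)`, the data of a matrix ordering on `V`. -/
abbrev MatrixCones (V : Type*) : Type _ := (n : ℕ) → Set (Matrix (Fin n) (Fin n) V)

section General

variable {V W : Type*} [AddCommGroup V] [Module ℂ V] [AddCommGroup W] [Module ℂ W]

/-- The product `A D A^*` of a scalar matrix `A`, a matrix `D` with entries in `V`, and the
adjoint of `A`. -/
def conjProd {a b : Type*} [Fintype b] (A : Matrix a b ℂ) (D : Matrix b b V) : Matrix a a V :=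
  Matrix.of fun i j => ∑ x, ∑ y, (A i x * star (A j y)) • D x y

/-- A linear map is completely positive from `(V, C)` to `(W, C')` if all its amplifications
`φ^(n)`, `n ≥ 1`, which apply `φ` to each entry, map `C_n` into `C'_n`. -/
def IsCompletelyPositive (C : MatrixCones V) (C' : MatrixCones W) (φ : V →ₗ[ℂ] W) : Prop :=
  ∀ n : ℕ, 0 < n → ∀ A ∈ C n, φ.mapMatrix A ∈ C' n

/-- The cones `D_n^{k-max}`: all `A D A^*`, where `D = diag(D_1, …, D_q)` is block diagonal with
blocks `D_l ∈ M_k(V)^+`, and `A` is a scalar `n × qk` matrix. (The columns of `A` are indexed by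
pairs: position inside a block, number of the block.) -/
def kMaxPre (P : MatrixCones V) (k : ℕ) : MatrixCones V := fun n =>
  {X | ∃ (q : ℕ) (A : Matrix (Fin n) (Fin k × Fin q) ℂ) (D : Fin q → Matrix (Fin k) (Fin k) V),
    (∀ l, D l ∈ P k) ∧ X = conjProd A (Matrix.blockDiagonal D)}

/-- The cones `C_n^{k-max}` of `OMAX_k(V)`, for the operator system `(V, P, e)`: the
Archimedeanization of the cones `D_n^{k-max}`, with `e_n = diag(e, …, e)`. -/
def omaxCones (P : MatrixCones V) (e : V) (k : ℕ) : MatrixCones V := fun n =>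
  {X | ∀ r : ℝ, 0 < r → (r : ℂ) • Matrix.diagonal (fun _ : Fin n => e) + X ∈ kMaxPre P k n}

end General

/-- The usual operator system structure of `M_m = B(ℂ^m)`: an element of `M_n(M_m)` is positive
if it is positive semidefinite as an `nm × nm` complex matrix. -/
def matCones (m : ℕ) : MatrixCones (Mat m) := fun n =>
  {X | (Matrix.comp (Fin n) (Fin n) (Fin m) (Fin m) ℂ X).PosSemidef}

/-- The matrix cones of `OMAX_k(M_m)`, the super `k`-maximal operator system structure on `M_m`
(its order unit being the identity matrix). -/
def OMAX (k m : ℕ) : MatrixCones (Mat m) := omaxCones (matCones m) 1 k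

/-! Functionals on `M_n ⊗ M_m` are functionals on `M_n(M_m)`, with the tensor `a ⊗ b` being the
block matrix `(a_ij b)`. -/

/-- `M_n ⊗ M_m`, as the block matrices `M_n(M_m)`. -/
abbrev MatTensor (n m : ℕ) : Type := Matrix (Fin n) (Fin n) (Mat m)

variable {n m : ℕ}

/-- Positive linear functionals on `M_n ⊗ M_m`. -/
def IsPositiveFunctional (f : MatTensor n m →ₗ[ℂ] ℂ) : Prop :=
  ∀ X ∈ matCones m n, 0 ≤ f X

/-- States on `M_n ⊗ M_m`. -/
def IsState (s : MatTensor n m →ₗ[ℂ] ℂ) : Prop :=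
  IsPositiveFunctional s ∧ s 1 = 1

/-- The density (Choi) matrix `(s(E_ij ⊗ E_kl))`, whose `(i,j)` block has `(k,l)` entry
`s(E_ij ⊗ E_kl)`. -/
def densityMatrix (s : MatTensor n m →ₗ[ℂ] ℂ) : Matrix (Fin n × Fin m) (Fin n × Fin m) ℂ :=
  Matrix.of fun a b => s (Matrix.single a.1 b.1 (Matrix.single a.2 b.2 1))

/-- `U ∈ ℂ^n ⊗ ℂ^m` has a Schmidt decomposition with `r` terms: `U = ∑ α_e u_e ⊗ v_e` with
`α_e ≥ 0`, and with `(u_e)` and `(v_e)` orthonormal. -/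
def HasSchmidtDecomposition (U : Fin n × Fin m → ℂ) (r : ℕ) : Prop :=
  ∃ (u : Fin r → EuclideanSpace ℂ (Fin n)) (v : Fin r → EuclideanSpace ℂ (Fin m)) (α : Fin r → ℝ),
    Orthonormal ℂ u ∧ Orthonormal ℂ v ∧ (∀ e, 0 ≤ α e) ∧
      ∀ i j, U (i, j) = ∑ e, (α e : ℂ) * (u e i * v e j)

/-- The Schmidt rank of a vector: the least number of terms of a Schmidt decomposition. -/
noncomputable def schmidtRank (U : Fin n × Fin m → ℂ) : ℕ∞ :=
  ⨅ (r : ℕ) (_ : HasSchmidtDecomposition U r), (r : ℕ∞)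

/-- The Schmidt number of a positive semidefinite matrix `ρ`: the least `k` such that `ρ` is a
finite sum of matrices `U U^*` with `U` of Schmidt rank at most `k` (and `⊤` if there is none,
that is, if `ρ` is not positive semidefinite). -/
noncomputable def schmidtNumber (ρ : Matrix (Fin n × Fin m) (Fin n × Fin m) ℂ) : ℕ∞ :=
  ⨅ (k : ℕ) (_ : ∃ (q : ℕ) (U : Fin q → Fin n × Fin m → ℂ),
    (∀ l, schmidtRank (U l) ≤ k) ∧ ρ = ∑ l, Matrix.vecMulVec (U l) (star (U l))), (k : ℕ∞)

/-- A `k`-separable state: the Schmidt number of its density matrix is at most `k`. -/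
def IsKSeparableState (k : ℕ) (s : MatTensor n m →ₗ[ℂ] ℂ) : Prop :=
  IsState s ∧ schmidtNumber (densityMatrix s) ≤ k

/-- A positive functional `f` is `k`-separable if it is zero or if `f / f(I)` is a `k`-separable
state. -/
def IsKSeparable (k : ℕ) (f : MatTensor n m →ₗ[ℂ] ℂ) : Prop :=
  IsPositiveFunctional f ∧ (f ≠ 0 → IsKSeparableState k ((f 1)⁻¹ • f))

/-- A linear map `φ : M_p → M_m` is `k`-partially entanglement breaking if `s ∘ φ^(n)` is
`k`-separable for every state `s` on `M_n ⊗ M_m`, for every `n ≥ 1`. -/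
def IsKPEB (k : ℕ) {p m : ℕ} (φ : Mat p →ₗ[ℂ] Mat m) : Prop :=
  ∀ n : ℕ, 0 < n → ∀ s : MatTensor n m →ₗ[ℂ] ℂ, IsState s →
    IsKSeparable k (s ∘ₗ (φ.mapMatrix : MatTensor n p →ₗ[ℂ] MatTensor n m))

end OpSys

/-! Complete positivity is tested on a single positive element, the matrix `(E_ij)` in `M_p(M_p)`,
whose image is the Choi matrix of `φ`. For each `r > 0`, adding `r • I` puts it in `kMaxPre`; the
sum is the Choi matrix of `φ + r • ψ` with `ψ x = tr(x) • 1`. Splitting the blocks `D_l` into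
rank-one terms gives this map Kraus operators that factor through `ℂ^k`
(`exists_kraus_of_mem_kMaxPre`). A Kraus operator `V` sends a vector of the density matrix of `s`,
read as a matrix `W`, to `W * V`, of rank at most `k` (`isSumOfRankLE_densityMatrix_comp`). The
singular value decomposition turns this rank bound into a Schmidt rank bound.

The passage `r → 0` rests on closedness: after trace normalization, the sums in question form the
convex hull of a compact set, which is compact in finite dimension (`isSumOfRankLE_of_forall_pos`).
-/

/-- In a finite-dimensional space, the convex hull of a compact set is compact. -/
theorem IsCompact.convexHull_of_finiteDimensional {E : Type*} [AddCommGroup E] [Module ℝ E]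
    [TopologicalSpace E] [IsTopologicalAddGroup E] [ContinuousSMul ℝ E] [FiniteDimensional ℝ E]
    {s : Set E} (hs : IsCompact s) : IsCompact (convexHull ℝ s) := by
  -- Carathéodory: `finrank + 1` points suffice, so the hull is a finite union of continuous images
  -- of compact sets.
  have key : convexHull ℝ s = ⋃ N ∈ Finset.range (Module.finrank ℝ E + 2),
      (fun x : (Fin N → ℝ) × (Fin N → E) => ∑ i, x.1 i • x.2 i) ''
        (stdSimplex ℝ (Fin N) ×ˢ Set.univ.pi fun _ => s) := by
    ext x
    simp only [Set.mem_iUnion, Set.mem_image, Set.mem_prod, Prod.exists, Finset.mem_range]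
    constructor
    · intro hx
      obtain ⟨ι, _, z, w, hz, hind, hw, hw1, rfl⟩ := eq_pos_convex_span_of_mem_convexHull hx
      refine ⟨Fintype.card ι, ?_, w ∘ (Fintype.equivFin ι).symm, z ∘ (Fintype.equivFin ι).symm,
        ⟨⟨fun i => (hw _).le, ?_⟩, fun i _ => hz ⟨_, rfl⟩⟩, ?_⟩
      · have := hind.card_le_finrank_succ
        have := Submodule.finrank_le (vectorSpan ℝ (Set.range z))
        omega
      · rw [← hw1]
        exact Equiv.sum_comp (Fintype.equivFin ι).symm w
      · exact Equiv.sum_comp (Fintype.equivFin ι).symm fun i => w i • z i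
    · rintro ⟨N, -, w, z, ⟨⟨hw, hw1⟩, hz⟩, rfl⟩
      exact mem_convexHull_of_exists_fintype w z hw hw1 (fun i => hz i trivial) rfl
  rw [key]
  refine Finset.isCompact_biUnion _ fun N _ => IsCompact.image ?_ (by fun_prop)
  exact (isCompact_stdSimplex ℝ (Fin N)).prod (isCompact_univ_pi fun _ => hs)

/-- Matrices of rank at most `k` form a closed set. -/
theorem Matrix.isClosed_setOf_rank_le (n m k : ℕ) :
    IsClosed {M : Matrix (Fin n) (Fin m) ℂ | M.rank ≤ k} := by
  let T : Matrix (Fin n) (Fin m) ℂ →ₗ[ℂ] ((Fin m → ℂ) →L[ℂ] (Fin n → ℂ)) :=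
    LinearMap.toContinuousLinearMap.toLinearMap ∘ₗ Matrix.toLin'.toLinearMap
  have hT : Continuous T := T.continuous_of_finiteDimensional
  have hopen := (isOpen_setOfPred_nat_le_rank (𝕜 := ℂ) (E := Fin m → ℂ)
    (F := Fin n → ℂ) (k + 1)).preimage hT
  rw [← isOpen_compl_iff]
  convert hopen using 1
  ext M
  have : LinearMap.rank (T M : (Fin m → ℂ) →ₗ[ℂ] (Fin n → ℂ)) = (M.rank : Cardinal) := by
    rw [Matrix.rank, LinearMap.rank, Module.finrank_eq_rank]
    rfl
  simp only [Set.mem_compl_iff, Set.mem_ofPred_eq, Set.mem_preimage, this, Nat.cast_le]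
  omega

namespace OpSys

variable {n m : ℕ}

/-! ### Schmidt rank and matrix rank -/

/-- The vector `U ∈ ℂ^n ⊗ ℂ^m` as an `n × m` matrix. -/
abbrev vecMatrix (U : Fin n × Fin m → ℂ) : Matrix (Fin n) (Fin m) ℂ :=
  Matrix.of fun i j => U (i, j)

/-- The singular value decomposition. -/
theorem hasSchmidtDecomposition_rank (U : Fin n × Fin m → ℂ) :
    HasSchmidtDecomposition U (vecMatrix U).rank := by
  set M := vecMatrix U
  have hH : (M.conjTranspose * M).IsHermitian := Matrix.isHermitian_conjTranspose_mul_self M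
  have hpos := (Matrix.posSemidef_conjTranspose_mul_self M).eigenvalues_nonneg
  set lam := hH.eigenvalues
  let b := hH.eigenvectorBasis
  let f : Fin m → EuclideanSpace ℂ (Fin n) := fun j => WithLp.toLp 2 (M.mulVec (b j).ofLp)
  have hf (i j : Fin m) : inner ℂ (f i) (f j) = if i = j then (lam j : ℂ) else 0 := by
    have h1 : inner ℂ (f i) (f j) = inner ℂ (b i) ((lam j : ℂ) • b j) := by
      have h2 := hH.mulVec_eigenvectorBasis j
      rw [← Matrix.mulVec_mulVec] at h2
      simp only [EuclideanSpace.inner_eq_star_dotProduct, f, WithLp.ofLp_smul]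
      rw [Matrix.star_mulVec, dotProduct_comm, ← Matrix.dotProduct_mulVec, h2, dotProduct_comm]
      rfl
    rw [h1, inner_smul_right, orthonormal_iff_ite.1 b.orthonormal i j]
    simp
  have hcard : Fintype.card {i // lam i ≠ 0} = M.rank := by
    rw [← Matrix.rank_conjTranspose_mul_self M, hH.rank_eq_card_non_zero_eigs]
  let e : Fin M.rank ≃ {i // lam i ≠ 0} := (Fintype.equivFinOfCardEq hcard).symm
  have hpos' (j : {i // lam i ≠ 0}) : 0 < lam j := lt_of_le_of_ne (hpos _) (Ne.symm j.2)
  have hsq (j : Fin m) : ((Real.sqrt (lam j) : ℝ) : ℂ) * (Real.sqrt (lam j) : ℝ) = lam j := by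
    rw [← Complex.ofReal_mul, Real.mul_self_sqrt (hpos j)]
  -- The right vectors are conjugated because `M = ∑ (M b_j) b_j^*`; normalizing `M b_j` produces
  -- the singular value `√λ_j`.
  refine ⟨fun a => (((Real.sqrt (lam (e a)))⁻¹ : ℝ) : ℂ) • f (e a),
    fun a => WithLp.toLp 2 (star (b (e a)).ofLp), fun a => Real.sqrt (lam (e a)), ?_, ?_,
    fun _ => Real.sqrt_nonneg _, ?_⟩
  · rw [orthonormal_iff_ite]
    intro x y
    rw [inner_smul_left, inner_smul_right, hf, Complex.conj_ofReal]
    by_cases h : x = y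
    · subst h
      have : ((Real.sqrt (lam (e x)) : ℝ) : ℂ) ≠ 0 :=
        Complex.ofReal_ne_zero.2 (Real.sqrt_pos.2 (hpos' _)).ne'
      simp only [if_true, ← hsq]
      push_cast
      field_simp
    · have : (e x : Fin m) ≠ e y := fun h' => h (e.injective (Subtype.ext h'))
      simp [h, this]
  · rw [orthonormal_iff_ite]
    intro x y
    have := orthonormal_iff_ite.1 b.orthonormal (e y) (e x)
    rw [EuclideanSpace.inner_eq_star_dotProduct] at this ⊢
    simp only [star_star]
    rw [dotProduct_comm, dotProduct_comm] at this
    rw [dotProduct_comm, this]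
    simp [Subtype.ext_iff.symm, e.injective.eq_iff, eq_comm]
  · intro i j
    have hU : U (i, j) = ∑ x : Fin m, f x i * star (b x j) := by
      have h1 : (hH.eigenvectorUnitary : Matrix (Fin m) (Fin m) ℂ) *
          star (hH.eigenvectorUnitary : Matrix (Fin m) (Fin m) ℂ) = 1 :=
        Unitary.coe_mul_star_self _
      have h2 : (M * ((hH.eigenvectorUnitary : Matrix (Fin m) (Fin m) ℂ) *
          star (hH.eigenvectorUnitary : Matrix (Fin m) (Fin m) ℂ))) i j = U (i, j) := by
        rw [h1, Matrix.mul_one]; rfl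
      rw [← h2, ← Matrix.mul_assoc, Matrix.mul_apply]
      rfl
    rw [hU]
    have hzero (x : Fin m) (hx : lam x = 0) : f x = 0 := by
      rw [← inner_self_eq_zero (𝕜 := ℂ), hf]; simp [hx]
    have h3 : ∑ x : Fin m, f x i * star (b x j) =
        ∑ x : {i // lam i ≠ 0}, f x i * star (b x j) := by
      rw [← Finset.sum_filter_of_ne (p := fun x => lam x ≠ 0)]
      · exact Finset.sum_subtype _ (by simp) _
      · intro x _ hx h0
        exact hx (by simp [hzero x h0])
    rw [h3, ← e.sum_comp]
    refine Finset.sum_congr rfl fun a _ => ?_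
    have : ((Real.sqrt (lam (e a)) : ℝ) : ℂ) ≠ 0 :=
      Complex.ofReal_ne_zero.2 (Real.sqrt_pos.2 (hpos' _)).ne'
    simp only [PiLp.smul_apply, smul_eq_mul, Pi.star_apply]
    push_cast
    field_simp

theorem schmidtRank_le_rank (U : Fin n × Fin m → ℂ) :
    schmidtRank U ≤ ((vecMatrix U).rank : ℕ∞) :=
  iInf₂_le _ (hasSchmidtDecomposition_rank U)

/-! ### Closedness of bounded Schmidt number -/

/-- Sums of matrices `U U^*` with `U` of rank at most `k`: the matrices of Schmidt number at
most `k`. -/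
def IsSumOfRankLE (k : ℕ) (ρ : Matrix (Fin n × Fin m) (Fin n × Fin m) ℂ) : Prop :=
  ∃ (ι : Type) (_ : Fintype ι) (U : ι → Fin n × Fin m → ℂ),
    (∀ l, (vecMatrix (U l)).rank ≤ k) ∧ ρ = ∑ l, Matrix.vecMulVec (U l) (star (U l))

theorem IsSumOfRankLE.schmidtNumber_le {k : ℕ} {ρ : Matrix (Fin n × Fin m) (Fin n × Fin m) ℂ}
    (h : IsSumOfRankLE k ρ) : schmidtNumber ρ ≤ k := by
  obtain ⟨ι, _, U, hU, rfl⟩ := h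
  refine iInf₂_le k ⟨Fintype.card ι, U ∘ (Fintype.equivFin ι).symm, fun l => ?_, ?_⟩
  · exact (schmidtRank_le_rank _).trans (Nat.cast_le.2 (hU _))
  · exact (Equiv.sum_comp (Fintype.equivFin ι).symm
      fun l => Matrix.vecMulVec (U l) (star (U l))).symm

theorem rank_vecMatrix_smul_le (c : ℂ) (U : Fin n × Fin m → ℂ) :
    (vecMatrix (c • U)).rank ≤ (vecMatrix U).rank := by
  have : vecMatrix (c • U) = Matrix.diagonal (fun _ => c) * vecMatrix U := by
    ext i j; exact (Matrix.diagonal_mul (fun _ => c) (vecMatrix U) i j).symm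
  rw [this]
  exact Matrix.rank_mul_le_right _ _

theorem vecMulVec_smul_star_smul (c : ℂ) (U : Fin n × Fin m → ℂ) :
    Matrix.vecMulVec (c • U) (star (c • U)) =
      (‖c‖ ^ 2 : ℝ) • Matrix.vecMulVec U (star U) := by
  ext x y
  have : c * star c = ((‖c‖ ^ 2 : ℝ) : ℂ) := by
    rw [Complex.star_def, Complex.mul_conj, Complex.normSq_eq_norm_sq]
  simp only [Matrix.vecMulVec_apply, Pi.smul_apply, Pi.star_apply, smul_eq_mul, star_mul',
    Matrix.smul_apply, Complex.real_smul, ← this]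
  ring

/-- The rank one projections onto vectors of Schmidt rank at most `k`. -/
def rankLEProjections (n m k : ℕ) : Set (Matrix (Fin n × Fin m) (Fin n × Fin m) ℂ) :=
  (fun U => Matrix.vecMulVec U (star U)) ''
    {U | (vecMatrix U).rank ≤ k ∧ ∑ x, ‖U x‖ ^ 2 = 1}

theorem isCompact_rankLEProjections (n m k : ℕ) : IsCompact (rankLEProjections n m k) := by
  refine IsCompact.image ?_ ?_
  · refine Metric.isCompact_of_isClosed_isBounded ?_ ?_
    · refine IsClosed.inter (s₁ := {U | (vecMatrix U).rank ≤ k})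
        (s₂ := {U | ∑ x, ‖U x‖ ^ 2 = 1}) ?_ (isClosed_eq (by fun_prop) (by fun_prop))
      exact (Matrix.isClosed_setOf_rank_le n m k).preimage
        (continuous_matrix fun i j => continuous_apply (i, j))
    · refine (Metric.isBounded_closedBall (x := 0) (r := 1)).subset ?_
      rintro U ⟨-, hU⟩
      rw [mem_closedBall_zero_iff, pi_norm_le_iff_of_nonneg zero_le_one]
      intro x
      have := Finset.single_le_sum (f := fun x => ‖U x‖ ^ 2) (fun _ _ => by positivity)
        (Finset.mem_univ x)
      rw [hU] at this
      exact (sq_le_one_iff₀ (norm_nonneg _)).1 this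
  · exact continuous_matrix fun i j => by
      simp only [Matrix.vecMulVec_apply, Pi.star_apply]
      fun_prop

theorem trace_vecMulVec_star (U : Fin n × Fin m → ℂ) :
    (Matrix.vecMulVec U (star U)).trace = ((∑ x, ‖U x‖ ^ 2 : ℝ) : ℂ) := by
  simp only [Matrix.trace, Matrix.diag_apply, Matrix.vecMulVec_apply, Pi.star_apply]
  push_cast
  refine Finset.sum_congr rfl fun x _ => ?_
  rw [Complex.star_def, Complex.mul_conj, Complex.normSq_eq_norm_sq]
  push_cast; rfl

/-- Since `U U^*` has trace `‖U‖²`, dividing by the trace yields a convex combination with weights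
proportional to `‖U_l‖²`. -/
theorem IsSumOfRankLE.inv_trace_smul_mem {k : ℕ}
    {ρ : Matrix (Fin n × Fin m) (Fin n × Fin m) ℂ} (h : IsSumOfRankLE k ρ) (h0 : ρ.trace ≠ 0) :
    (ρ.trace.re)⁻¹ • ρ ∈ convexHull ℝ (rankLEProjections n m k) := by
  classical
  obtain ⟨ι, _, U, hU, rfl⟩ := h
  let w : ι → ℝ := fun l => ∑ x, ‖U l x‖ ^ 2
  have hw0 (l) : 0 ≤ w l := Finset.sum_nonneg fun _ _ => by positivity
  have htr : (∑ l, Matrix.vecMulVec (U l) (star (U l))).trace = ((∑ l, w l : ℝ) : ℂ) := by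
    rw [Matrix.trace_sum]
    simp only [trace_vecMulVec_star]
    rw [Complex.ofReal_sum]
  rw [htr] at h0 ⊢
  rw [Complex.ofReal_re]
  rw [Complex.ofReal_ne_zero] at h0
  let z : ι → Matrix (Fin n × Fin m) (Fin n × Fin m) ℂ :=
    fun l => (w l)⁻¹ • Matrix.vecMulVec (U l) (star (U l))
  have hz (l : ι) (hl : w l ≠ 0) : z l ∈ rankLEProjections n m k := by
    have hl' : 0 < w l := lt_of_le_of_ne (hw0 l) hl.symm
    have hn : ‖(((Real.sqrt (w l))⁻¹ : ℝ) : ℂ)‖ ^ 2 = (w l)⁻¹ := by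
      rw [Complex.norm_real, Real.norm_eq_abs, sq_abs, inv_pow, Real.sq_sqrt hl'.le]
    refine ⟨(((Real.sqrt (w l))⁻¹ : ℝ) : ℂ) • U l,
      ⟨(rank_vecMatrix_smul_le _ _).trans (hU l), ?_⟩, ?_⟩
    · simp only [Pi.smul_apply, smul_eq_mul, norm_mul, mul_pow, hn, ← Finset.mul_sum]
      exact inv_mul_cancel₀ hl
    · dsimp only
      rw [vecMulVec_smul_star_smul, hn]
  have hzw (l : ι) : w l • z l = Matrix.vecMulVec (U l) (star (U l)) := by
    by_cases hl : w l = 0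
    · have : U l = 0 := by
        ext x
        have := (Finset.sum_eq_zero_iff_of_nonneg fun _ _ => by positivity).1 hl x
          (Finset.mem_univ x)
        simpa using this
      rw [hl, this]; ext; simp [Matrix.vecMulVec_apply]
    · simp [z, smul_smul, mul_inv_cancel₀ hl]
  -- Terms with `U_l = 0` have no normalization, so they are dropped before taking the center of
  -- mass.
  have hcm := Finset.univ.centerMass_filter_ne_zero (w := w) z
  have := (Finset.univ.filter fun l => w l ≠ 0).centerMass_mem_convexHull (w := w) (z := z)
    (s := rankLEProjections n m k) (fun l _ => hw0 l)
    (by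
      rw [Finset.sum_filter_ne_zero]
      exact lt_of_le_of_ne (Finset.sum_nonneg fun l _ => hw0 l) h0.symm)
    (fun l hl => hz l (Finset.mem_filter.1 hl).2)
  rw [hcm, Finset.centerMass] at this
  simpa only [hzw] using this

theorem isSumOfRankLE_of_mem_convexHull {k : ℕ} {ρ : Matrix (Fin n × Fin m) (Fin n × Fin m) ℂ}
    (h : ρ ∈ convexHull ℝ (rankLEProjections n m k)) : IsSumOfRankLE k ρ := by
  obtain ⟨ι, _, z, w, hz, -, hw, -, rfl⟩ := eq_pos_convex_span_of_mem_convexHull h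
  choose U hU hUz using fun i => hz ⟨i, rfl⟩
  refine ⟨Fin (Fintype.card ι), inferInstance, fun a =>
    ((Real.sqrt (w ((Fintype.equivFin ι).symm a)) : ℝ) : ℂ) • U ((Fintype.equivFin ι).symm a),
    fun a => (rank_vecMatrix_smul_le _ _).trans (hU _).1, ?_⟩
  rw [← (Fintype.equivFin ι).symm.sum_comp]
  refine Finset.sum_congr rfl fun a _ => ?_
  rw [vecMulVec_smul_star_smul, Complex.norm_real, Real.norm_eq_abs, sq_abs,
    Real.sq_sqrt (hw _).le, ← hUz]

/-- A normalized limit of matrices of Schmidt number at most `k` has Schmidt number at most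
`k`. -/
theorem isSumOfRankLE_of_forall_pos {k : ℕ}
    {ρ σ : Matrix (Fin n × Fin m) (Fin n × Fin m) ℂ} (h1 : ρ.trace = 1)
    (h : ∀ r : ℝ, 0 < r → IsSumOfRankLE k (ρ + r • σ)) : IsSumOfRankLE k ρ := by
  apply isSumOfRankLE_of_mem_convexHull
  have hclosed : IsClosed (convexHull ℝ (rankLEProjections n m k)) :=
    (isCompact_rankLEProjections n m k).convexHull_of_finiteDimensional.isClosed
  have hc : Continuous fun r : ℝ => (ρ + r • σ).trace := by
    simp only [Matrix.trace_add, Matrix.trace_smul]; fun_prop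
  have hre : Continuous fun r : ℝ => (ρ + r • σ).trace.re := Complex.continuous_re.comp hc
  have h0 : (ρ + (0 : ℝ) • σ).trace = 1 := by simp [h1]
  -- The trace stays near `1`, so normalizing moves the approximants into the hull without changing
  -- the limit.
  have ht : Filter.Tendsto (fun r : ℝ => ((ρ + r • σ).trace.re)⁻¹ • (ρ + r • σ))
      (nhdsWithin 0 (Set.Ioi 0)) (nhds ρ) := by
    have : ContinuousAt (fun r : ℝ => ((ρ + r • σ).trace.re)⁻¹ • (ρ + r • σ)) 0 :=
      (hre.continuousAt.inv₀ (by simp [h1])).smul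
        (by fun_prop)
    have h2 := this.tendsto
    simp only [h0] at h2
    simp only [Complex.one_re, inv_one, one_smul, zero_smul, add_zero] at h2
    exact h2.mono_left nhdsWithin_le_nhds
  refine hclosed.mem_of_tendsto ht ?_
  have hne : ∀ᶠ r in nhds (0 : ℝ), (ρ + r • σ).trace ≠ 0 :=
    hc.continuousAt.eventually_ne (by rw [h0]; exact one_ne_zero)
  filter_upwards [nhdsWithin_le_nhds hne, self_mem_nhdsWithin] with r hr hr0
  exact (h r hr0).inv_trace_smul_mem hr

theorem IsSumOfRankLE.smul {k : ℕ} {ρ : Matrix (Fin n × Fin m) (Fin n × Fin m) ℂ}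
    (h : IsSumOfRankLE k ρ) {c : ℝ} (hc : 0 ≤ c) : IsSumOfRankLE k (c • ρ) := by
  obtain ⟨ι, _, U, hU, rfl⟩ := h
  refine ⟨ι, inferInstance, fun l => ((Real.sqrt c : ℝ) : ℂ) • U l,
    fun l => (rank_vecMatrix_smul_le _ _).trans (hU l), ?_⟩
  rw [Finset.smul_sum]
  refine Finset.sum_congr rfl fun l _ => ?_
  rw [vecMulVec_smul_star_smul, Complex.norm_real, Real.norm_eq_abs, sq_abs, Real.sq_sqrt hc]

/-! ### Functionals and their density matrices -/

theorem apply_single_eq_sum (f : MatTensor n m →ₗ[ℂ] ℂ) (i j : Fin n) (Y : Mat m) :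
    f (Matrix.single i j Y) = ∑ a, ∑ b, Y a b * densityMatrix f (i, a) (j, b) := by
  have h : Matrix.single i j Y =
      ∑ a, ∑ b, Y a b • Matrix.single i j (Matrix.single a b (1 : ℂ)) := by
    conv_lhs => rw [Matrix.matrix_eq_sum_single Y]
    ext i' j' a' b'
    by_cases hij : i = i' ∧ j = j'
    · obtain ⟨rfl, rfl⟩ := hij
      simp [Matrix.sum_apply, Matrix.single_apply]
    · simp [Matrix.sum_apply, hij]
  rw [h, map_sum]
  refine Finset.sum_congr rfl fun a _ => ?_
  rw [map_sum]
  refine Finset.sum_congr rfl fun b _ => ?_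
  rw [map_smul, smul_eq_mul]
  rfl

theorem apply_eq_sum (f : MatTensor n m →ₗ[ℂ] ℂ) (X : MatTensor n m) :
    f X = ∑ i, ∑ j, ∑ a, ∑ b, X i j a b * densityMatrix f (i, a) (j, b) := by
  conv_lhs => rw [Matrix.matrix_eq_sum_single X]
  simp only [map_sum, apply_single_eq_sum]

theorem eq_zero_of_densityMatrix_eq_zero {f : MatTensor n m →ₗ[ℂ] ℂ} (h : densityMatrix f = 0) :
    f = 0 := by
  ext1 X
  simp [apply_eq_sum f X, h]

theorem trace_densityMatrix (f : MatTensor n m →ₗ[ℂ] ℂ) : (densityMatrix f).trace = f 1 := by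
  rw [apply_eq_sum f 1, Matrix.trace, Fintype.sum_prod_type]
  refine Finset.sum_congr rfl fun i _ => ?_
  rw [Finset.sum_eq_single i (fun j _ hj => by simp [Matrix.one_apply_ne hj.symm]) (by simp)]
  simp [Matrix.one_apply]

theorem dotProduct_densityMatrix_mulVec {f : MatTensor n m →ₗ[ℂ] ℂ} (w : Fin n × Fin m → ℂ) :
    star w ⬝ᵥ (densityMatrix f).mulVec w =
      f (Matrix.of fun i j => Matrix.of fun a b => star (w (i, a)) * w (j, b)) := by
  rw [apply_eq_sum]
  simp only [dotProduct, Matrix.mulVec, Fintype.sum_prod_type, Finset.mul_sum, Matrix.of_apply,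
    Pi.star_apply]
  refine Finset.sum_congr rfl fun i _ => ?_
  rw [Finset.sum_comm]
  refine Finset.sum_congr rfl fun j _ => Finset.sum_congr rfl fun a _ =>
    Finset.sum_congr rfl fun b _ => by ring

theorem IsPositiveFunctional.posSemidef_densityMatrix {f : MatTensor n m →ₗ[ℂ] ℂ}
    (hf : IsPositiveFunctional f) : (densityMatrix f).PosSemidef := by
  have h (w : Fin n × Fin m → ℂ) : 0 ≤ star w ⬝ᵥ (densityMatrix f).mulVec w := by
    rw [dotProduct_densityMatrix_mulVec]
    apply hf
    exact Matrix.posSemidef_vecMulVec_star_self w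
  rw [← Matrix.isPositive_toEuclideanLin_iff, LinearMap.isPositive_iff_complex]
  intro x
  have hx := h x.ofLp
  have e : inner ℂ ((densityMatrix f).toEuclideanLin x) x =
      star (star x.ofLp ⬝ᵥ (densityMatrix f).mulVec x.ofLp) := by
    rw [EuclideanSpace.inner_eq_star_dotProduct, Matrix.star_dotProduct, star_star,
      dotProduct_comm]
    rfl
  rw [e]
  obtain ⟨h1, h2⟩ := Complex.nonneg_iff.1 hx
  refine ⟨?_, by simpa using h1⟩
  apply Complex.ext <;> simp [← h2]

/-- The pairing of `X` with the density matrix involves no transpose, so `U U^*` contributes the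
quadratic form of `X` at the conjugate of `U`. -/
theorem IsSumOfRankLE.isPositiveFunctional {k : ℕ} {f : MatTensor n m →ₗ[ℂ] ℂ}
    (h : IsSumOfRankLE k (densityMatrix f)) : IsPositiveFunctional f := by
  obtain ⟨ι, _, U, -, hU⟩ := h
  intro X hX
  have : f X = ∑ l, star (star (U l)) ⬝ᵥ
      (Matrix.comp (Fin n) (Fin n) (Fin m) (Fin m) ℂ X).mulVec (star (U l)) := by
    rw [apply_eq_sum, hU]
    simp only [dotProduct, Matrix.mulVec, Fintype.sum_prod_type, Finset.mul_sum, Matrix.sum_apply,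
      Matrix.vecMulVec_apply, star_star, Matrix.comp_apply]
    conv_rhs => rw [Finset.sum_comm]
    refine Finset.sum_congr rfl fun i _ => ?_
    conv_lhs => rw [Finset.sum_comm]
    conv_rhs => rw [Finset.sum_comm]
    refine Finset.sum_congr rfl fun a _ => ?_
    conv_rhs => rw [Finset.sum_comm]
    refine Finset.sum_congr rfl fun j _ => ?_
    conv_rhs => rw [Finset.sum_comm]
    refine Finset.sum_congr rfl fun b _ => Finset.sum_congr rfl fun l _ => ?_
    simp only [Pi.star_apply]
    ring
  rw [this]
  exact Finset.sum_nonneg fun l _ => hX.dotProduct_mulVec_nonneg _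

theorem densityMatrix_add (f g : MatTensor n m →ₗ[ℂ] ℂ) :
    densityMatrix (f + g) = densityMatrix f + densityMatrix g := rfl

theorem densityMatrix_smul (c : ℂ) (f : MatTensor n m →ₗ[ℂ] ℂ) :
    densityMatrix (c • f) = c • densityMatrix f := rfl

theorem isKSeparable_of_forall_pos {k : ℕ} {f g : MatTensor n m →ₗ[ℂ] ℂ}
    (h : ∀ r : ℝ, 0 < r → IsSumOfRankLE k (densityMatrix (f + (r : ℂ) • g))) :
    IsKSeparable k f := by
  have hpos : IsPositiveFunctional f := by
    intro X hX
    have ht : Filter.Tendsto (fun r : ℝ => f X + (r : ℂ) * g X)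
        (nhdsWithin 0 (Set.Ioi 0)) (nhds (f X)) := by
      have : Continuous fun r : ℝ => f X + (r : ℂ) * g X := by fun_prop
      simpa using (this.tendsto 0).mono_left nhdsWithin_le_nhds
    refine ge_of_tendsto ht ?_
    filter_upwards [self_mem_nhdsWithin] with r hr
    exact (h r hr).isPositiveFunctional X hX
  refine ⟨hpos, fun hf => ?_⟩
  have hpsd := hpos.posSemidef_densityMatrix
  -- `f 1` is the trace of a positive semidefinite matrix, which vanishes only with the matrix.
  have h1 : f 1 ≠ 0 := by
    rw [← trace_densityMatrix, Ne, hpsd.trace_eq_zero_iff]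
    exact fun h0 => hf (eq_zero_of_densityMatrix_eq_zero h0)
  have hnn : 0 ≤ f 1 := trace_densityMatrix f ▸ hpsd.trace_nonneg
  obtain ⟨t, ht, hft⟩ : ∃ t : ℝ, 0 ≤ t ∧ (t : ℂ) = f 1 :=
    ⟨(f 1).re, (Complex.nonneg_iff.1 hnn).1,
      Complex.ext rfl (by simpa using (Complex.nonneg_iff.1 hnn).2)⟩
  have hstate : ((f 1)⁻¹ • f) 1 = 1 := by simp [h1]
  have hsum : IsSumOfRankLE k (densityMatrix ((f 1)⁻¹ • f)) := by
    refine isSumOfRankLE_of_forall_pos (σ := densityMatrix ((f 1)⁻¹ • g)) ?_ fun r hr => ?_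
    · rw [trace_densityMatrix, hstate]
    · convert (h r hr).smul (inv_nonneg.2 ht) using 1
      rw [densityMatrix_smul, densityMatrix_smul, densityMatrix_add, densityMatrix_smul, ← hft]
      ext x y
      simp
      ring
  exact ⟨⟨hsum.isPositiveFunctional, hstate⟩, hsum.schmidtNumber_le⟩

/-! ### Kraus operators and composition -/

/-- A Kraus decomposition with Kraus operators of rank at most `k`. -/
theorem exists_kraus_of_mem_kMaxPre {k p : ℕ} {X : MatTensor p m}
    (h : X ∈ kMaxPre (matCones m) k p) :
    ∃ (ι : Type) (_ : Fintype ι) (V : ι → Matrix (Fin m) (Fin p) ℂ),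
      (∀ l, (V l).rank ≤ k) ∧ ∀ i j a b, X i j a b = ∑ l, V l a i * star (V l b j) := by
  obtain ⟨q, A, D, hD, rfl⟩ := h
  choose N d hd using fun l => Matrix.posSemidef_iff_eq_sum_vecMulVec.1 (hD l)
  have hd' (l : Fin q) (x y : Fin k) (a b : Fin m) :
      D l x y a b = ∑ t, d l t (x, a) * star (d l t (y, b)) := by
    have := congrFun (congrFun (hd l) (x, a)) (y, b)
    simpa [Matrix.sum_apply, Matrix.vecMulVec_apply] using this
  -- Each operator is an `m × k` matrix times a `k × p` matrix, hence the rank bound.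
  refine ⟨Σ l, Fin (N l), inferInstance, fun lt =>
    (Matrix.of fun a x => d lt.1 lt.2 (x, a)) * (Matrix.of fun x i => A i (x, lt.1)),
    fun lt => (Matrix.rank_mul_le_left _ _).trans (Matrix.rank_le_width _), fun i j a b => ?_⟩
  have hsplit : conjProd A (Matrix.blockDiagonal D) i j a b =
      ∑ l, ∑ x, ∑ y, A i (x, l) * star (A j (y, l)) * D l x y a b := by
    simp only [conjProd, Matrix.of_apply, Matrix.sum_apply, Matrix.smul_apply, smul_eq_mul,
      Fintype.sum_prod_type, Matrix.blockDiagonal_apply]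
    rw [Finset.sum_comm]
    refine Finset.sum_congr rfl fun l _ => Finset.sum_congr rfl fun x _ =>
      Finset.sum_congr rfl fun y _ => ?_
    rw [Finset.sum_eq_single l (fun l' _ hl => by simp [hl.symm]) (by simp)]
    simp
  rw [hsplit, Fintype.sum_sigma]
  refine Finset.sum_congr rfl fun l _ => ?_
  simp only [hd', Matrix.mul_apply, Matrix.of_apply, star_sum, star_mul', Finset.sum_mul_sum]
  simp only [Finset.mul_sum]
  rw [Finset.sum_comm_cycle]
  refine Finset.sum_congr rfl fun t _ => Finset.sum_congr rfl fun x _ =>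
    Finset.sum_congr rfl fun y _ => by ring

theorem vecMatrix_uncurry (M : Matrix (Fin n) (Fin m) ℂ) :
    vecMatrix (fun x => M x.1 x.2) = M := rfl

/-- A positive functional composed with a map with Kraus operators of rank at most `k`. -/
theorem isSumOfRankLE_densityMatrix_comp {k p : ℕ} {χ : Mat p →ₗ[ℂ] Mat m}
    {X : MatTensor p m} (hX : X ∈ kMaxPre (matCones m) k p)
    (hχ : ∀ i j, χ (Matrix.single i j 1) = X i j)
    {s : MatTensor n m →ₗ[ℂ] ℂ} (hs : IsPositiveFunctional s) :
    IsSumOfRankLE k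
      (densityMatrix (s ∘ₗ (χ.mapMatrix : MatTensor n p →ₗ[ℂ] MatTensor n m))) := by
  obtain ⟨ι, _, V, hV, hVχ⟩ := exists_kraus_of_mem_kMaxPre hX
  obtain ⟨N, W, hW⟩ := Matrix.posSemidef_iff_eq_sum_vecMulVec.1 hs.posSemidef_densityMatrix
  refine ⟨ι × Fin N, inferInstance, fun lt x => (vecMatrix (W lt.2) * V lt.1) x.1 x.2,
    fun lt => ?_, ?_⟩
  · rw [vecMatrix_uncurry]
    exact (Matrix.rank_mul_le_right _ _).trans (hV lt.1)
  ext ⟨i, a'⟩ ⟨j, b'⟩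
  have h1 : densityMatrix (s ∘ₗ (χ.mapMatrix : MatTensor n p →ₗ[ℂ] MatTensor n m)) (i, a') (j, b')
      = s (Matrix.single i j (χ (Matrix.single a' b' 1))) :=
    congrArg s (Matrix.map_single i j (Matrix.single a' b' (1 : ℂ)) χ)
  have h2 (a b : Fin m) : χ (Matrix.single a' b' 1) a b = ∑ l, V l a a' * star (V l b b') := by
    rw [hχ, hVχ]
  have h3 (x y : Fin n × Fin m) : densityMatrix s x y = ∑ t, W t x * star (W t y) := by
    rw [hW, Matrix.sum_apply]
    rfl
  rw [h1, apply_single_eq_sum, Matrix.sum_apply, Fintype.sum_prod_type]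
  simp only [h2, h3, Matrix.vecMulVec_apply, Pi.star_apply, Matrix.mul_apply, star_sum,
    star_mul', Finset.sum_mul_sum, Matrix.of_apply]
  calc _ = ∑ a, ∑ l, ∑ t, ∑ b, W t (i, a) * V l a a' * (star (W t (j, b)) * star (V l b b')) := by
        refine Finset.sum_congr rfl fun a _ => ?_
        rw [Finset.sum_comm]
        refine Finset.sum_congr rfl fun l _ => ?_
        rw [Finset.sum_comm]
        exact Finset.sum_congr rfl fun t _ => Finset.sum_congr rfl fun b _ => by ring
    _ = _ := by
        rw [Finset.sum_comm]
        exact Finset.sum_congr rfl fun l _ => Finset.sum_comm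

/-- This is `v v^*` for the unnormalized maximally entangled vector `v = ∑ e_i ⊗ e_i`. -/
theorem posSemidef_matrixUnits (p : ℕ) :
    (Matrix.of fun i j => Matrix.single i j 1 : MatTensor p p) ∈ matCones p p := by
  change Matrix.PosSemidef _
  convert Matrix.posSemidef_vecMulVec_self_star
    (fun x : Fin p × Fin p => if x.1 = x.2 then (1 : ℂ) else 0) using 1
  ext ⟨i, a⟩ ⟨j, b⟩
  by_cases h1 : i = a <;> by_cases h2 : j = b <;>
    simp [Matrix.vecMulVec_apply, h1, h2]

end OpSys

theorem mainTheorem12 (k p m : ℕ) (hk : 1 ≤ k) (hp : 1 ≤ p) (hm : 1 ≤ m)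
    (φ : Matrix (Fin p) (Fin p) ℂ →ₗ[ℂ] Matrix (Fin m) (Fin m) ℂ)
    (hφ : OpSys.IsCompletelyPositive (OpSys.matCones p) (OpSys.OMAX k m) φ) :
    OpSys.IsKPEB k φ := by
  intro n hn s hs
  -- Since `tr(E_ij) • 1 = δ_ij • 1`, the Choi matrix of `ψ` is the order unit of `M_p(M_m)`.
  let ψ : OpSys.Mat p →ₗ[ℂ] OpSys.Mat m := (Matrix.traceLinearMap (Fin p) ℂ ℂ).smulRight 1
  refine OpSys.isKSeparable_of_forall_pos (g := s ∘ₗ ψ.mapMatrix) fun r hr => ?_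
  have key := OpSys.isSumOfRankLE_densityMatrix_comp (χ := φ + (r : ℂ) • ψ) (k := k) (n := n)
    (hφ p hp _ (OpSys.posSemidef_matrixUnits p) r hr) (fun i j => ?_) hs.1
  · convert key using 2
    ext1 X
    have hX : (φ + (r : ℂ) • ψ).mapMatrix X = φ.mapMatrix X + (r : ℂ) • ψ.mapMatrix X := rfl
    simp only [LinearMap.add_apply, LinearMap.smul_apply, LinearMap.comp_apply, hX, map_add,
      map_smul]
  · ext a b
    by_cases hij : i = j
    · subst hij; simp [ψ, add_comm]
    · simp [ψ, hij, Matrix.trace_single_eq_of_ne]
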